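/- Let $P$ be a smooth finite-dimensional (Hausdorff) manifold with Poisson bivector field $\eta$, so that $\{f,g\}_P=\langle\eta,\mathrm df\wedge\mathrm dg\rangle$. Bivectors are regarded as antisymmetric two-tensors, $a\wedge b=\frac12(a\otimes b-b\otimes a)$ for covectors $a,b$ (so that $\langle\mu,a\wedge b\rangle=\mu(a,b)$ for a bivector $\mu$), and $\eta(\alpha)$ denotes the vector with $\beta(\eta(\alpha))=\eta(\alpha,\beta)$. Let $p:TP\to P$ be the projection. The cotangent bundle $T^*P$ is a Lie algebroid with anchor $\eta$ and bracket $[\alpha,\beta]=L_{\eta(\alpha)}\beta-L_{\eta(\beta)}\alpha-\mathrm d(\eta(\alpha,\beta))$, and its dual $TP$ carries the bivector field defining the bracket $\{\,,\}_{TP}$ determined by $$\{\widetilde\alpha,\widetilde\beta\}_{TP}(v)=[\alpha,\beta](v),\qquad \{p^*f,p^*g\}_{TP}=0,\qquad \{\widetilde\alpha,p^*f\}_{TP}(v)=\eta(\alpha(x))\cdot f$$ for all closed one-forms $\alpha,\beta$ and smooth functions $f,g$ on $P$ and all $v\in T_xP$, where $\widetilde\alpha(v)=\alpha(v)$. (These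 equations are satisfied by exactly one bivector field on $TP$.) Let $\nabla$ be a smooth torsion-free connection on $TP$. For $v\in T_xP$ let $\mathfrak D\eta(v)=\nabla_v\eta$ be the vertical component of the derivative of $\eta$ along $v$, for the connection induced by $\nabla$ on bivectors. For a smooth map $\pi:TP\to P$ let $\partial_1\pi(v),\partial_2\pi(v):T_xP\to T_{\pi(v)}P$ be the compositions of the derivative of $\pi$ at $v$ with the vertical lift $u\mapsto\frac{\mathrm d}{\mathrm dt}|_{t=0}(v+tu)$ and with the $\nabla$-horizontal lift $T_xP\to T_v(TP)$, respectively. For linear maps $A,B:T_xP\to T_{\pi(v)}P$ put $A\odot B=A\otimes B+B\otimes A$, acting on two-tensors. Then for all smooth real- or complex-valued functions $f,g$ on $P$, all $x\in P$ and all $v\in T_xP$, $$\{\pi^*f,\pi^*g\}_{TP}(v)=\big\langle(\partial_1\pi(v)\otimes\partial_1\pi(v))(\mathfrak D\eta(v))+2(\partial_1\pi(v)\otimes\partial_2\pi(v))(\eta(x)),\ \mathrm d_{\pi(v)}f\wedge\mathrm d_{\pi(v)}g\big\rangle .$$ In particular, $\pi$ is Poisson (that is, $\{\pi^*f,\pi^*g\}_{TP}=\pi^*\{f,g\}_P$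 for all smooth $f,g$) if and only if $$\tfrac12(\partial_1\pi(v)\odot\partial_1\pi(v))(\mathfrak D\eta(v))+(\partial_1\pi(v)\odot\partial_2\pi(v))(\eta(x))=\eta(\pi(v))$$ for all $x\in P$ and all $v\in T_xP$. -/

import Mathlib

open scoped Manifold ContDiff TensorProduct
open Bundle

noncomputable section

namespace PoissonTangent

/-! ### Linear algebra of two-tensors -/

section Algebra

variable {𝕜 : Type*} [RCLike 𝕜]
  {V : Type*} [AddCommGroup V] [Module ℝ V] [TopologicalSpace V]
  {W : Type*} [AddCommGroup W] [Module ℝ W] [TopologicalSpace W]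

/-- `⟨t, a ⊗ b⟩` for a two-tensor `t` and two (real or complex valued) covectors `a`, `b`. -/
def pair (t : V ⊗[ℝ] V) (a b : V →L[ℝ] 𝕜) : 𝕜 :=
  LinearMap.mul' ℝ 𝕜 (TensorProduct.map (a : V →ₗ[ℝ] 𝕜) (b : V →ₗ[ℝ] 𝕜) t)

/-- `⟨t, a ∧ b⟩` with `a ∧ b = (a ⊗ b - b ⊗ a) / 2`. If `t` is a bivector, that is an antisymmetric
two-tensor, then `⟨t, a ∧ b⟩ = ⟨t, a ⊗ b⟩ = t(a, b)`. -/
def wedgePair (t : V ⊗[ℝ] V) (a b : V →L[ℝ] 𝕜) : 𝕜 :=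
  (1 / 2 : 𝕜) * (pair t a b - pair t b a)

/-- The anchor `a ↦ t(a, ·)` from covectors to vectors: `b (sharp t a) = ⟨t, a ⊗ b⟩`. -/
def sharp (t : V ⊗[ℝ] V) (a : V →L[ℝ] ℝ) : V :=
  TensorProduct.lid ℝ V (TensorProduct.map (a : V →ₗ[ℝ] ℝ) LinearMap.id t)

/-- `A ⊗ B` acting on two-tensors. -/
def tensorMap (A B : V →L[ℝ] W) : V ⊗[ℝ] V →ₗ[ℝ] W ⊗[ℝ] W :=
  TensorProduct.map (A : V →ₗ[ℝ] W) (B : V →ₗ[ℝ] W)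

/-- The symmetric product `A ⊙ B = A ⊗ B + B ⊗ A`. -/
def symProd (A B : V →L[ℝ] W) : V ⊗[ℝ] V →ₗ[ℝ] W ⊗[ℝ] W :=
  tensorMap A B + tensorMap B A

/-- Bivectors are the antisymmetric two-tensors. -/
def IsBivector (t : V ⊗[ℝ] V) : Prop := TensorProduct.comm ℝ V V t = -t

end Algebra

/-! ### Poisson bivector fields on a manifold -/

section Poisson

variable {𝕜 : Type*} [RCLike 𝕜]
  {E : Type*} [NormedAddCommGroup E] [NormedSpace ℝ E]
  {H : Type*} [TopologicalSpace H] (I : ModelWithCorners ℝ E H)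
  {M : Type*} [TopologicalSpace M] [ChartedSpace H M]

/-- The bracket `{f, g} = ⟨Π, df ∧ dg⟩` of a bivector field `Π`. -/
def bracket (Pi : ∀ x : M, TangentSpace I x ⊗[ℝ] TangentSpace I x) (f g : M → 𝕜) (x : M) : 𝕜 :=
  wedgePair (Pi x) (mvfderiv I f x) (mvfderiv I g x)

/-- `Pi` is a (smooth) Poisson bivector field. -/
structure IsPoisson (Pi : ∀ x : M, TangentSpace I x ⊗[ℝ] TangentSpace I x) : Prop where
  isBivector : ∀ x, IsBivector (Pi x)
  smooth : ∀ f g : M → ℝ, ContMDiff I 𝓘(ℝ, ℝ) ∞ f → ContMDiff I 𝓘(ℝ, ℝ) ∞ g →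
    ContMDiff I 𝓘(ℝ, ℝ) ∞ (bracket I Pi f g)
  jacobi : ∀ f g h : M → ℝ, ContMDiff I 𝓘(ℝ, ℝ) ∞ f → ContMDiff I 𝓘(ℝ, ℝ) ∞ g →
    ContMDiff I 𝓘(ℝ, ℝ) ∞ h → ∀ x,
    bracket I Pi f (bracket I Pi g h) x + bracket I Pi g (bracket I Pi h f) x
      + bracket I Pi h (bracket I Pi f g) x = 0

/-- `φ : N → M` is a Poisson map: `{φ^* f, φ^* g}_N = φ^* {f, g}_M` for all smooth `𝕜`-valued
functions `f`, `g` on `M`. -/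
def IsPoissonMap (𝕜 : Type*) [RCLike 𝕜]
    {E' : Type*} [NormedAddCommGroup E'] [NormedSpace ℝ E']
    {H' : Type*} [TopologicalSpace H'] (J : ModelWithCorners ℝ E' H')
    {N : Type*} [TopologicalSpace N] [ChartedSpace H' N]
    (PiN : ∀ y : N, TangentSpace J y ⊗[ℝ] TangentSpace J y)
    (PiM : ∀ x : M, TangentSpace I x ⊗[ℝ] TangentSpace I x) (φ : N → M) : Prop :=
  ∀ f g : M → 𝕜, ContMDiff I 𝓘(ℝ, 𝕜) ∞ f → ContMDiff I 𝓘(ℝ, 𝕜) ∞ g →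
    ∀ y, bracket J PiN (f ∘ φ) (g ∘ φ) y = bracket I PiM f g (φ y)

end Poisson

section Tangent

variable {E : Type*} [NormedAddCommGroup E] [NormedSpace ℝ E]
  {P : Type*} [TopologicalSpace P] [ChartedSpace E P] [IsManifold 𝓘(ℝ, E) ∞ P]

/-! ### One-forms and the Lie algebroid `T*P` -/

/-- The function `v ↦ α(v)` on `TP` defined by a one-form `α` on `P`. -/
def tildeForm (α : ∀ x : P, TangentSpace 𝓘(ℝ, E) x →L[ℝ] ℝ) (v : TangentBundle 𝓘(ℝ, E) P) : ℝ :=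
  α v.proj v.snd

/-- A one-form on `P` is smooth when its associated fibrewise linear function on `TP` is. -/
def IsSmoothForm (α : ∀ x : P, TangentSpace 𝓘(ℝ, E) x →L[ℝ] ℝ) : Prop :=
  ContMDiff 𝓘(ℝ, E).tangent 𝓘(ℝ, ℝ) ∞ (tildeForm α)

/-- The exterior derivative `dα(u, w) = U(α(W)) - W(α(U)) - α([U, W])` at `x`, where `U`, `W` are
vector fields, smooth near `x`, extending `u`, `w`. -/
def dForm (α : ∀ x : P, TangentSpace 𝓘(ℝ, E) x →L[ℝ] ℝ) (x : P) (u w : TangentSpace 𝓘(ℝ, E) x) : ℝ :=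
  mvfderiv 𝓘(ℝ, E) (fun y => α y (FiberBundle.extend E w y)) x u
    - mvfderiv 𝓘(ℝ, E) (fun y => α y (FiberBundle.extend E u y)) x w
    - α x (VectorField.mlieBracket 𝓘(ℝ, E) (FiberBundle.extend E u) (FiberBundle.extend E w) x)

/-- Closed one-forms. -/
def IsClosedForm (α : ∀ x : P, TangentSpace 𝓘(ℝ, E) x →L[ℝ] ℝ) : Prop :=
  ∀ x u w, dForm α x u w = 0

/-- The Lie derivative `(L_X β)(u) = X(β(U)) - β([X, U])` at `x`, where `U` is a vector field,
smooth near `x`, extending `u`. -/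
def lieDerivForm (X : ∀ x : P, TangentSpace 𝓘(ℝ, E) x)
    (β : ∀ x : P, TangentSpace 𝓘(ℝ, E) x →L[ℝ] ℝ) (x : P) (u : TangentSpace 𝓘(ℝ, E) x) : ℝ :=
  mvfderiv 𝓘(ℝ, E) (fun y => β y (FiberBundle.extend E u y)) x (X x)
    - β x (VectorField.mlieBracket 𝓘(ℝ, E) X (FiberBundle.extend E u) x)

/-- The bracket of the Lie algebroid `T*P` of a Poisson manifold,
`[α, β] = L_{η(α)} β - L_{η(β)} α - d(η(α, β))`, evaluated on a tangent vector `u` at `x`. -/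
def formBracket (η : ∀ x : P, TangentSpace 𝓘(ℝ, E) x ⊗[ℝ] TangentSpace 𝓘(ℝ, E) x)
    (α β : ∀ x : P, TangentSpace 𝓘(ℝ, E) x →L[ℝ] ℝ) (x : P) (u : TangentSpace 𝓘(ℝ, E) x) : ℝ :=
  lieDerivForm (fun y => sharp (η y) (α y)) β x u
    - lieDerivForm (fun y => sharp (η y) (β y)) α x u
    - mvfderiv 𝓘(ℝ, E) (fun y => wedgePair (η y) (α y) (β y)) x u

/-! ### The Poisson structure of `TP` -/

/-- The three equations by which the Poisson structure of `TP`, the dual of the Lie algebroid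
`T*P`, is defined: `{α~, β~}(v) = [α, β](v)`, `{p^*f, p^*g} = 0` and `{α~, p^*f}(v) = η(α(x)) · f`
for closed one-forms `α`, `β` and functions `f`, `g` on `P`, and `v` in `T_x P`. -/
structure IsTangentPoisson (η : ∀ x : P, TangentSpace 𝓘(ℝ, E) x ⊗[ℝ] TangentSpace 𝓘(ℝ, E) x)
    (Pi : ∀ v : TangentBundle 𝓘(ℝ, E) P,
      TangentSpace 𝓘(ℝ, E).tangent v ⊗[ℝ] TangentSpace 𝓘(ℝ, E).tangent v) : Prop where
  isBivector : ∀ v, IsBivector (Pi v)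
  form_form : ∀ α β : (∀ x : P, TangentSpace 𝓘(ℝ, E) x →L[ℝ] ℝ),
    IsSmoothForm α → IsClosedForm α → IsSmoothForm β → IsClosedForm β →
    ∀ v : TangentBundle 𝓘(ℝ, E) P,
      bracket 𝓘(ℝ, E).tangent Pi (tildeForm α) (tildeForm β) v = formBracket η α β v.proj v.snd
  fun_fun : ∀ f g : P → ℝ, ContMDiff 𝓘(ℝ, E) 𝓘(ℝ, ℝ) ∞ f → ContMDiff 𝓘(ℝ, E) 𝓘(ℝ, ℝ) ∞ g →
    ∀ v : TangentBundle 𝓘(ℝ, E) P,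
      bracket 𝓘(ℝ, E).tangent Pi (fun w : TangentBundle 𝓘(ℝ, E) P => f w.proj)
        (fun w : TangentBundle 𝓘(ℝ, E) P => g w.proj) v = 0
  form_fun : ∀ (α : ∀ x : P, TangentSpace 𝓘(ℝ, E) x →L[ℝ] ℝ) (f : P → ℝ),
    IsSmoothForm α → IsClosedForm α → ContMDiff 𝓘(ℝ, E) 𝓘(ℝ, ℝ) ∞ f →
    ∀ v : TangentBundle 𝓘(ℝ, E) P,
      bracket 𝓘(ℝ, E).tangent Pi (tildeForm α) (fun w : TangentBundle 𝓘(ℝ, E) P => f w.proj) v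
        = mvfderiv 𝓘(ℝ, E) f v.proj (sharp (η v.proj) (α v.proj))

/-- The vertical lift `u ↦ d/dt|_{t=0} (v + t u)` from `T_x P` to `T_v(TP)`: the derivative at `v`
of the inclusion of the fibre `T_x P`. -/
def verticalLift (v : TangentBundle 𝓘(ℝ, E) P) :
    TangentSpace 𝓘(ℝ, E) v.proj →L[ℝ] TangentSpace 𝓘(ℝ, E).tangent v :=
  mfderiv 𝓘(ℝ, E) 𝓘(ℝ, E).tangent
    (fun w : E => (⟨v.proj, w⟩ : TangentBundle 𝓘(ℝ, E) P)) (v.snd : E)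

/-- The derivative at `x` of the vector field extending `v ∈ T_x P` with constant components in the
chart at `x`. -/
def chartLift (v : TangentBundle 𝓘(ℝ, E) P) :
    TangentSpace 𝓘(ℝ, E) v.proj →L[ℝ] TangentSpace 𝓘(ℝ, E).tangent v :=
  mfderiv 𝓘(ℝ, E) 𝓘(ℝ, E).tangent
    (fun y : P => (⟨y, FiberBundle.extend E v.snd y⟩ : TangentBundle 𝓘(ℝ, E) P)) v.proj

/-! ### Horizontal and vertical derivatives -/

/-- The horizontal lift of `u ∈ T_x P` to `T_v(TP)`, where `v ∈ T_x P`: the vector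
`dX(u) - (∇_u X)^vert`, where `X` is a vector field, smooth near `x`, extending `v`. The horizontal
space of the connection at `v` is the range of this map; `p_*` is its inverse. -/
def horizontalLift (cov : CovariantDerivative 𝓘(ℝ, E) E (TangentSpace 𝓘(ℝ, E) : P → Type _))
    (v : TangentBundle 𝓘(ℝ, E) P) :
    TangentSpace 𝓘(ℝ, E) v.proj →L[ℝ] TangentSpace 𝓘(ℝ, E).tangent v :=
  chartLift v - (verticalLift v).comp (cov (FiberBundle.extend E v.snd) v.proj)

/-- The vertical component `∂₁φ(v) : T_x P → T_{φ(v)} P` of the derivative of `φ : TP → P`. -/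
def vertDeriv (φ : TangentBundle 𝓘(ℝ, E) P → P) (v : TangentBundle 𝓘(ℝ, E) P) :
    TangentSpace 𝓘(ℝ, E) v.proj →L[ℝ] TangentSpace 𝓘(ℝ, E) (φ v) :=
  (mfderiv 𝓘(ℝ, E).tangent 𝓘(ℝ, E) φ v).comp (verticalLift v)

/-- The horizontal component `∂₂φ(v) : T_x P → T_{φ(v)} P` of the derivative of `φ : TP → P`. -/
def horDeriv (cov : CovariantDerivative 𝓘(ℝ, E) E (TangentSpace 𝓘(ℝ, E) : P → Type _))
    (φ : TangentBundle 𝓘(ℝ, E) P → P) (v : TangentBundle 𝓘(ℝ, E) P) :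
    TangentSpace 𝓘(ℝ, E) v.proj →L[ℝ] TangentSpace 𝓘(ℝ, E) (φ v) :=
  (mfderiv 𝓘(ℝ, E).tangent 𝓘(ℝ, E) φ v).comp (horizontalLift cov v)

/-! ### Chart frames -/

variable [FiniteDimensional ℝ E]

/-- The local frame `e_i = ∂/∂x^i` of `TP` given by the chart at `x`. -/
def frame (x : P) (i : Fin (Module.finrank ℝ E)) (y : P) : TangentSpace 𝓘(ℝ, E) y :=
  (trivializationAt E (TangentSpace 𝓘(ℝ, E) : P → Type _) x).symmL ℝ y (Module.finBasis ℝ E i)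

/-- The local coframe `dx^i` dual to `frame x`. -/
def coframe (x : P) (i : Fin (Module.finrank ℝ E)) (y : P) : TangentSpace 𝓘(ℝ, E) y →L[ℝ] ℝ :=
  (LinearMap.toContinuousLinearMap ((Module.finBasis ℝ E).coord i)).comp
    ((trivializationAt E (TangentSpace 𝓘(ℝ, E) : P → Type _) x).continuousLinearMapAt ℝ y)

/-- The components `η^{ij}` of a two-tensor field in the chart at `x`. -/
def component (η : ∀ x : P, TangentSpace 𝓘(ℝ, E) x ⊗[ℝ] TangentSpace 𝓘(ℝ, E) x) (x : P)
    (i j : Fin (Module.finrank ℝ E)) (y : P) : ℝ :=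
  pair (η y) (coframe x i y) (coframe x j y)

/-- The Poisson bivector field of `TP`. Let `x^i` be the coordinates of the chart at the base point
`x` of `v`, and `x^i`, `v^i = (dx^i)~` the induced coordinates of `TP`. The bivector is the one with
`{v^i, v^j} = d(η^{ij})(v)`, `{v^i, x^j} = η^{ij}` and `{x^i, x^j} = 0`. Here `∂/∂v^i` is the vertical
lift and `∂/∂x^i` the chart lift of the frame vector `e_i`. -/
def tangentPoisson (η : ∀ x : P, TangentSpace 𝓘(ℝ, E) x ⊗[ℝ] TangentSpace 𝓘(ℝ, E) x)
    (v : TangentBundle 𝓘(ℝ, E) P) :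
    TangentSpace 𝓘(ℝ, E).tangent v ⊗[ℝ] TangentSpace 𝓘(ℝ, E).tangent v :=
  ∑ i, ∑ j,
    (mvfderiv 𝓘(ℝ, E) (component η v.proj i j) v.proj v.snd •
        (verticalLift v (frame v.proj i v.proj) ⊗ₜ[ℝ] verticalLift v (frame v.proj j v.proj))
      + component η v.proj i j v.proj •
        (verticalLift v (frame v.proj i v.proj) ⊗ₜ[ℝ] chartLift v (frame v.proj j v.proj)
          + chartLift v (frame v.proj i v.proj) ⊗ₜ[ℝ] verticalLift v (frame v.proj j v.proj)))

/-- The vertical component `𝔇η(v)` of the derivative of `η` along `v ∈ T_x P`, that is the covariant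
derivative `∇_v η` for the connection induced on two-tensors: near `x`, `η = ∑ η^{ij} e_i ⊗ e_j`, and
the Leibniz rule gives
`∇_v η = ∑ (d(η^{ij})(v) e_i ⊗ e_j + η^{ij} (∇_v e_i ⊗ e_j + e_i ⊗ ∇_v e_j))`. -/
def covDerivBivector (cov : CovariantDerivative 𝓘(ℝ, E) E (TangentSpace 𝓘(ℝ, E) : P → Type _))
    (η : ∀ x : P, TangentSpace 𝓘(ℝ, E) x ⊗[ℝ] TangentSpace 𝓘(ℝ, E) x)
    (v : TangentBundle 𝓘(ℝ, E) P) :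
    TangentSpace 𝓘(ℝ, E) v.proj ⊗[ℝ] TangentSpace 𝓘(ℝ, E) v.proj :=
  ∑ i, ∑ j,
    (mvfderiv 𝓘(ℝ, E) (component η v.proj i j) v.proj v.snd •
        (frame v.proj i v.proj ⊗ₜ[ℝ] frame v.proj j v.proj)
      + component η v.proj i j v.proj •
        (cov (frame v.proj i) v.proj v.snd ⊗ₜ[ℝ] frame v.proj j v.proj
          + frame v.proj i v.proj ⊗ₜ[ℝ] cov (frame v.proj j) v.proj v.snd))

end Tangent

end PoissonTangent

end

open PoissonTangent

open PoissonTangent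

/-! Write `V` and `C` for the vertical and chart lifts at `v`, and `v̄` for the extension of `v`
with constant components in the chart at `x`. The bivector of `TP` is the sum over `i, j` of
`dη^{ij}(v) Ve_i ⊗ Ve_j + η^{ij} (Ve_i ⊗ Ce_j + Ce_i ⊗ Ve_j)`. The horizontal lift is `Hu = Cu -
V(∇_u v̄)`. Since `[e_i, v̄] = 0` at `x` and the torsion vanishes, `∇_{e_i} v̄ = ∇_v e_i`.
Substituting `Ce_i = He_i + V(∇_v e_i)` collects the purely vertical terms into `(V ⊗ V)(∇_v η)` and
leaves `(V ⊙ H)(η)` (`cov_frame_apply`, `tangentPoisson_eq`). Applying `dφ` to both factors turns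
`V` and `H` into the two partial derivatives of `φ`, and the chain rule gives the bracket formula.
The criterion follows because differentials of global smooth functions separate bivectors
(`IsBivector.ext_mvfderiv`).

That this bivector satisfies the defining equations is a chart computation of the bracket of
one-forms (`formBracket_eq_sum`). Uniqueness (`IsTangentPoisson.eq`) holds because the equations
prescribe all pairings of the differentials `dx^i`, `dv^i`, realised near `v` by global functions
`p^*f` and `(df)~`. -/

namespace PoissonTangent

open Filter Topology

/-! ### Two-tensors and their pairings with covectors. -/

section Algebra

variable {𝕜 : Type*} [RCLike 𝕜]
  {V : Type*} [AddCommGroup V] [Module ℝ V] [TopologicalSpace V]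
  {W : Type*} [AddCommGroup W] [Module ℝ W] [TopologicalSpace W]
  {W' : Type*} [AddCommGroup W'] [Module ℝ W'] [TopologicalSpace W']

@[simp] lemma pair_tmul (u w : V) (a b : V →L[ℝ] 𝕜) : pair (u ⊗ₜ[ℝ] w) a b = a u * b w := by
  simp [pair]

@[simp] lemma pair_zero (a b : V →L[ℝ] 𝕜) : pair (0 : V ⊗[ℝ] V) a b = 0 := by
  simp [pair]

@[simp] lemma pair_add (s t : V ⊗[ℝ] V) (a b : V →L[ℝ] 𝕜) :
    pair (s + t) a b = pair s a b + pair t a b := by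
  simp [pair]

@[simp] lemma pair_neg (t : V ⊗[ℝ] V) (a b : V →L[ℝ] 𝕜) : pair (-t) a b = -pair t a b := by
  simp [pair]

@[simp] lemma pair_smul (c : ℝ) (t : V ⊗[ℝ] V) (a b : V →L[ℝ] 𝕜) :
    pair (c • t) a b = c • pair t a b := by
  simp [pair]

@[simp] lemma pair_sum {ι : Type*} (s : Finset ι) (t : ι → V ⊗[ℝ] V) (a b : V →L[ℝ] 𝕜) :
    pair (∑ i ∈ s, t i) a b = ∑ i ∈ s, pair (t i) a b := by
  simp [pair]

lemma pair_comm (t : V ⊗[ℝ] V) (a b : V →L[ℝ] 𝕜) :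
    pair (TensorProduct.comm ℝ V V t) a b = pair t b a := by
  induction t with
  | zero => simp
  | tmul u w => simp [mul_comm]
  | add s t hs ht => simp [hs, ht]

lemma IsBivector.pair_swap {t : V ⊗[ℝ] V} (ht : IsBivector t) (a b : V →L[ℝ] 𝕜) :
    pair t b a = -pair t a b := by
  rw [← pair_comm, ht, pair_neg]

lemma IsBivector.wedgePair_eq {t : V ⊗[ℝ] V} (ht : IsBivector t) (a b : V →L[ℝ] 𝕜) :
    wedgePair t a b = pair t a b := by
  rw [wedgePair, ht.pair_swap a b]
  ring

@[simp] lemma tensorMap_tmul (A B : V →L[ℝ] W) (u w : V) :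
    tensorMap A B (u ⊗ₜ[ℝ] w) = A u ⊗ₜ[ℝ] B w := by
  simp [tensorMap]

lemma tensorMap_comp (D : W →L[ℝ] W') (A B : V →L[ℝ] W) (t : V ⊗[ℝ] V) :
    tensorMap (D.comp A) (D.comp B) t = tensorMap D D (tensorMap A B t) := by
  induction t with
  | zero => simp
  | tmul u w => simp
  | add s t hs ht => simp only [map_add, hs, ht]

lemma pair_comp (A : V →L[ℝ] W) (t : V ⊗[ℝ] V) (a b : W →L[ℝ] 𝕜) :
    pair t (a.comp A) (b.comp A) = pair (tensorMap A A t) a b := by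
  induction t with
  | zero => simp
  | tmul u w => simp
  | add s t hs ht => simp only [map_add, pair_add, hs, ht]

lemma wedgePair_comp (A : V →L[ℝ] W) (t : V ⊗[ℝ] V) (a b : W →L[ℝ] 𝕜) :
    wedgePair t (a.comp A) (b.comp A) = wedgePair (tensorMap A A t) a b := by
  simp only [wedgePair, pair_comp]

lemma comm_tensorMap (A B : V →L[ℝ] W) (t : V ⊗[ℝ] V) :
    TensorProduct.comm ℝ W W (tensorMap A B t) =
      tensorMap B A (TensorProduct.comm ℝ V V t) := by
  induction t with
  | zero => simp
  | tmul u w => simp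
  | add s t hs ht => simp only [map_add, hs, ht]

lemma IsBivector.tensorMap {t : V ⊗[ℝ] V} (ht : IsBivector t) (A : V →L[ℝ] W) :
    IsBivector (tensorMap A A t) := by
  rw [IsBivector, comm_tensorMap, ht, map_neg]

/-- The flip carries `(A ⊗ B) t` to `-(B ⊗ A) t`, so the two tensors have the same antisymmetric
part, which is all that `wedgePair` sees. -/
lemma IsBivector.wedgePair_add_tensorMap {t : V ⊗[ℝ] V} (ht : IsBivector t) (s : W ⊗[ℝ] W)
    (A B : V →L[ℝ] W) (a b : W →L[ℝ] 𝕜) :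
    wedgePair (s + (2 : ℝ) • PoissonTangent.tensorMap A B t) a b
      = wedgePair (s + symProd A B t) a b := by
  have h (a b : W →L[ℝ] 𝕜) : pair (PoissonTangent.tensorMap B A t) a b =
      -pair (PoissonTangent.tensorMap A B t) b a := by
    rw [← pair_comm, comm_tensorMap, ht, map_neg, pair_neg]
  simp only [wedgePair, symProd, LinearMap.add_apply, pair_add, h, two_smul]
  ring

/-- `sharp t` is characterised by `b (sharp t a) = ⟨t, a ⊗ b⟩`. -/
lemma apply_sharp (t : V ⊗[ℝ] V) (a b : V →L[ℝ] ℝ) : b (sharp t a) = pair t a b := by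
  induction t with
  | zero => simp [sharp]
  | tmul u w => simp [sharp]
  | add s t hs ht =>
    rw [pair_add, ← hs, ← ht, ← map_add]
    simp [sharp]

lemma sharp_sum_tmul {ι : Type*} [Fintype ι] (h : ι → ι → ℝ) (e : ι → V) (a : V →L[ℝ] ℝ) :
    sharp (∑ i, ∑ j, h i j • (e i ⊗ₜ[ℝ] e j)) a = ∑ i, ∑ j, (h i j * a (e i)) • e j := by
  simp [sharp, mul_smul]

/-- A two-tensor is the sum of its components with respect to a basis and its dual basis. -/
lemma eq_sum_pair {ι : Type*} [Fintype ι] (e : ι → V) (d : ι → V →L[ℝ] ℝ)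
    (hed : ∀ u, ∑ i, d i u • e i = u) (t : V ⊗[ℝ] V) :
    t = ∑ i, ∑ j, pair t (d i) (d j) • (e i ⊗ₜ[ℝ] e j) := by
  induction t with
  | zero => simp
  | tmul u w =>
    conv_lhs => rw [← hed u, ← hed w]
    simp [TensorProduct.sum_tmul, TensorProduct.tmul_sum, TensorProduct.smul_tmul', mul_smul,
      Finset.smul_sum]
    rw [Finset.sum_comm]
    exact Finset.sum_congr rfl fun i _ => Finset.sum_congr rfl fun j _ => by rw [smul_comm]
  | add s t hs ht =>
    conv_lhs => rw [hs, ht]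
    simp [add_smul, Finset.sum_add_distrib]

/-- Finitely many covectors which separate vectors also separate two-tensors. -/
lemma ext_pair {ι : Type*} [Fintype ι] (s : ι → V →L[ℝ] ℝ)
    (hs : ∀ u, (∀ i, s i u = 0) → u = 0) {t t' : V ⊗[ℝ] V}
    (h : ∀ i j, pair t (s i) (s j) = pair t' (s i) (s j)) : t = t' := by
  classical
  let S : V →ₗ[ℝ] ι → ℝ := LinearMap.pi fun i => (s i : V →ₗ[ℝ] ℝ)
  have hS : LinearMap.ker S = ⊥ := by
    refine (Submodule.eq_bot_iff _).2 fun u hu => hs u fun i => ?_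
    exact congrFun (LinearMap.mem_ker.1 hu) i
  -- The separating covectors need not be independent. A left inverse of their joint map still gives
  -- vectors `R (Pi.single i 1)` with which every `u` is recovered from the numbers `s i u`.
  obtain ⟨R, hR⟩ := S.exists_leftInverse_of_injective hS
  have key (t : V ⊗[ℝ] V) : t = ∑ i, ∑ j, pair t (s i) (s j) •
      (R (Pi.single i 1) ⊗ₜ[ℝ] R (Pi.single j 1)) := by
    refine eq_sum_pair _ s (fun u => ?_) t
    have h1 : R (S u) = u := LinearMap.congr_fun hR u
    conv_rhs => rw [← h1, pi_eq_sum_univ' (S u)]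
    simp only [map_sum, map_smul]
    refine Finset.sum_congr rfl fun i _ => ?_
    congr 2
  rw [key t, key t']
  simp only [h]

lemma pair_ofReal (t : V ⊗[ℝ] V) (a b : V →L[ℝ] ℝ) :
    pair t (RCLike.ofRealCLM.comp a : V →L[ℝ] 𝕜) (RCLike.ofRealCLM.comp b)
      = ((pair t a b : ℝ) : 𝕜) := by
  induction t with
  | zero => simp
  | tmul u w => simp
  | add s t hs ht => simp only [pair_add, hs, ht, RCLike.ofReal_add]

end Algebra

/-! ### Differentials of vector-valued functions. -/

section Derivatives

variable {E : Type*} [NormedAddCommGroup E] [NormedSpace ℝ E]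
  {H : Type*} [TopologicalSpace H] {I : ModelWithCorners ℝ E H}
  {M : Type*} [TopologicalSpace M] [ChartedSpace H M]
  {F : Type*} [NormedAddCommGroup F] [NormedSpace ℝ F]

lemma mvfderiv_congr {f g : M → F} {x : M} (h : f =ᶠ[𝓝 x] g) :
    mvfderiv I f x = mvfderiv I g x := by
  ext u
  have h' : (mfderiv I 𝓘(ℝ, F) f x : E →L[ℝ] F) = mfderiv I 𝓘(ℝ, F) g x :=
    h.mfderiv_eq
  exact congrArg (fun L : E →L[ℝ] F => L u) h'

/-- In the chart at `x`, a linear coordinate has itself as its differential at `x`. -/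
lemma mvfderiv_clm_extChartAt [IsManifold I 1 M] (L : E →L[ℝ] F) (x : M) (u : TangentSpace I x) :
    mvfderiv I (fun y => L (extChartAt I x y)) x u = L (show E from u) := by
  have h := mfderiv_comp_apply x (L.mdifferentiableAt (x := extChartAt I x x))
    (mdifferentiableAt_extChartAt (I := I) (mem_chart_source H x)) u
  rw [ContinuousLinearMap.mfderiv_eq, mfderiv_extChartAt_self] at h
  exact h

end Derivatives

/-! ### Vector fields constant in a chart, and exact one-forms. -/

section Fields

variable {E : Type*} [NormedAddCommGroup E] [NormedSpace ℝ E]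
  {P : Type*} [TopologicalSpace P] [ChartedSpace E P]

omit [NormedSpace ℝ E] in
lemma eventually_mem_source (x : P) : ∀ᶠ y in 𝓝 x, y ∈ (chartAt E x).source :=
  (chartAt E x).open_source.mem_nhds (mem_chart_source E x)

variable [IsManifold 𝓘(ℝ, E) ∞ P]

/-- The components of a tangent vector at `x` in the chart at `x`. -/
noncomputable def chartVec {x : P} (v : TangentSpace 𝓘(ℝ, E) x) : E :=
  (trivializationAt E (TangentSpace 𝓘(ℝ, E) : P → Type _) x).continuousLinearMapAt ℝ x v

lemma extend_apply {x y : P} (hy : y ∈ (chartAt E x).source) (v : TangentSpace 𝓘(ℝ, E) x) :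
    FiberBundle.extend E v y =
      (trivializationAt E (TangentSpace 𝓘(ℝ, E) : P → Type _) x).symmL ℝ y (chartVec v) := by
  rw [chartVec, Trivialization.continuousLinearMapAt_apply,
    Trivialization.linearMapAt_apply]
  simp only [FiberBundle.extend, FiberBundle.mem_baseSet_trivializationAt', if_true]
  exact (Trivialization.symmL_apply _ hy _).symm

lemma continuousLinearMapAt_extend {x y : P} (hy : y ∈ (chartAt E x).source)
    (v : TangentSpace 𝓘(ℝ, E) x) :
    (trivializationAt E (TangentSpace 𝓘(ℝ, E) : P → Type _) x).continuousLinearMapAt ℝ y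
      (FiberBundle.extend E v y) = chartVec v := by
  rw [extend_apply hy]
  exact Trivialization.continuousLinearMapAt_symmL _ hy _

lemma mdifferentiableAt_extend {x : P} (v : TangentSpace 𝓘(ℝ, E) x) :
    MDifferentiableAt 𝓘(ℝ, E) 𝓘(ℝ, E).tangent
      (fun y => (⟨y, FiberBundle.extend E v y⟩ : TangentBundle 𝓘(ℝ, E) P)) x :=
  FiberBundle.mdifferentiableAt_extend 𝓘(ℝ, E) E v

/-- Pulled back along the inverse chart, both fields are constant near the image of `x`, and
constant fields commute. -/
lemma mlieBracket_extend [CompleteSpace E] {x : P} (u w : TangentSpace 𝓘(ℝ, E) x) :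
    VectorField.mlieBracket 𝓘(ℝ, E) (FiberBundle.extend E u) (FiberBundle.extend E w) x = 0 := by
  have key (w : TangentSpace 𝓘(ℝ, E) x) :
      VectorField.mpullbackWithin 𝓘(ℝ, E) 𝓘(ℝ, E) (extChartAt 𝓘(ℝ, E) x).symm
      (FiberBundle.extend E w) Set.univ =ᶠ[𝓝 (extChartAt 𝓘(ℝ, E) x x)] fun _ => chartVec w := by
    filter_upwards [extChartAt_target_mem_nhds (I := 𝓘(ℝ, E)) x] with z hz
    have hy : (extChartAt 𝓘(ℝ, E) x).symm z ∈ (chartAt E x).source := by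
      rw [← extChartAt_source 𝓘(ℝ, E)]
      exact (extChartAt 𝓘(ℝ, E) x).map_target hz
    have h := isInvertible_mfderivWithin_extChartAt_symm hz
    rw [VectorField.mpullbackWithin_apply, extend_apply hy,
      TangentBundle.symmL_trivializationAt hy, (extChartAt 𝓘(ℝ, E) x).right_inv hz]
    simp only [modelWithCornersSelf_coe, Set.range_id, mfderivWithin_univ] at h ⊢
    exact ContinuousLinearMap.IsInvertible.inverse_apply_self h _
  rw [← VectorField.mlieBracketWithin_univ, VectorField.mlieBracketWithin_apply]
  simp only [modelWithCornersSelf_coe, Set.range_id, Set.preimage_univ, Set.univ_inter]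
  rw [((key u).filter_mono nhdsWithin_le_nhds).lieBracketWithin_vectorField_eq
    (key u).self_of_nhds ((key w).filter_mono nhdsWithin_le_nhds) (key w).self_of_nhds]
  rw [VectorField.lieBracketWithin, fderivWithin_fun_const, fderivWithin_fun_const]
  simp only [Pi.zero_apply, zero_apply, sub_self]
  exact map_zero _

/-- The direction `chartVec w` does not depend on `y`, so this formula can be differentiated once
more in the chart. -/
lemma mvfderiv_extend {f : P → ℝ} {x y : P} (hy : y ∈ (chartAt E x).source)
    (hf : MDifferentiableAt 𝓘(ℝ, E) 𝓘(ℝ, ℝ) f y) (w : TangentSpace 𝓘(ℝ, E) x) :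
    mvfderiv 𝓘(ℝ, E) f y (FiberBundle.extend E w y) =
      fderiv ℝ (f ∘ (extChartAt 𝓘(ℝ, E) x).symm) (extChartAt 𝓘(ℝ, E) x y) (chartVec w) := by
  have hy' : y ∈ (extChartAt 𝓘(ℝ, E) x).source := by rwa [extChartAt_source]
  have hs : MDifferentiableAt 𝓘(ℝ, E) 𝓘(ℝ, E) (extChartAt 𝓘(ℝ, E) x).symm
      (extChartAt 𝓘(ℝ, E) x y) := by
    simpa [mdifferentiableWithinAt_univ] using
      mdifferentiableWithinAt_extChartAt_symm ((extChartAt 𝓘(ℝ, E) x).map_source hy')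
  have hfs : MDifferentiableAt 𝓘(ℝ, E) 𝓘(ℝ, ℝ) (f ∘ (extChartAt 𝓘(ℝ, E) x).symm)
      (extChartAt 𝓘(ℝ, E) x y) := by
    refine MDifferentiableAt.comp _ ?_ hs
    rwa [(extChartAt 𝓘(ℝ, E) x).left_inv hy']
  have heq : f =ᶠ[𝓝 y] (f ∘ (extChartAt 𝓘(ℝ, E) x).symm) ∘ extChartAt 𝓘(ℝ, E) x := by
    filter_upwards [(chartAt E x).open_source.mem_nhds hy] with z hz
    rw [Function.comp_apply, Function.comp_apply,
      (extChartAt 𝓘(ℝ, E) x).left_inv (by rwa [extChartAt_source])]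
  rw [mvfderiv_congr heq, mvfderiv_comp_apply y hfs (mdifferentiableAt_extChartAt hy)]
  have h := continuousLinearMapAt_extend hy w
  rw [TangentBundle.continuousLinearMapAt_trivializationAt hy] at h
  exact (congrArg (mvfderiv 𝓘(ℝ, E) (f ∘ (extChartAt 𝓘(ℝ, E) x).symm)
    (extChartAt 𝓘(ℝ, E) x y)) h).trans (congrArg (fun L : E →L[ℝ] ℝ => L (chartVec w))
      mfderiv_eq_fderiv)

/-- Exact one-forms are closed. -/
lemma isClosedForm_mvfderiv [CompleteSpace E] {f : P → ℝ}
    (hf : ContMDiff 𝓘(ℝ, E) 𝓘(ℝ, ℝ) ∞ f) : IsClosedForm (mvfderiv 𝓘(ℝ, E) f) := by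
  intro x u w
  set φ := extChartAt 𝓘(ℝ, E) x with hφ
  have hF : ContDiffAt ℝ ∞ (f ∘ φ.symm) (φ x) := by
    have := (contMDiffAt_iff.1 (hf x)).2
    rw [modelWithCornersSelf_coe, Set.range_id, contDiffWithinAt_univ] at this
    exact this
  have h2 : (2 : WithTop ℕ∞) ≤ ∞ := WithTop.coe_le_coe.2 (le_top : (2 : ℕ∞) ≤ ⊤)
  have hdF : DifferentiableAt ℝ (fderiv ℝ (f ∘ φ.symm)) (φ x) :=
    (hF.fderiv_right (m := 1) (by rwa [one_add_one_eq_two])).differentiableAt (by simp)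
  have heq (w : TangentSpace 𝓘(ℝ, E) x) :
      (fun y => mvfderiv 𝓘(ℝ, E) f y (FiberBundle.extend E w y)) =ᶠ[𝓝 x]
        (fun z => fderiv ℝ (f ∘ φ.symm) z (chartVec w)) ∘ φ := by
    filter_upwards [eventually_mem_source (E := E) x] with y hy
    exact mvfderiv_extend hy ((hf y).mdifferentiableAt (by simp)) w
  have key (u w : TangentSpace 𝓘(ℝ, E) x) :
      mvfderiv 𝓘(ℝ, E) (fun y => mvfderiv 𝓘(ℝ, E) f y (FiberBundle.extend E w y)) x u =
        fderiv ℝ (fderiv ℝ (f ∘ φ.symm)) (φ x) (chartVec u) (chartVec w) := by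
    have hd : DifferentiableAt ℝ (fun z => fderiv ℝ (f ∘ φ.symm) z (chartVec w)) (φ x) :=
      hdF.clm_apply (differentiableAt_const _)
    have hmd : MDifferentiableAt 𝓘(ℝ, E) 𝓘(ℝ, ℝ)
        ((fun z => fderiv ℝ (f ∘ φ.symm) z (chartVec w)) ∘ φ) x :=
      hd.mdifferentiableAt.comp x (mdifferentiableAt_extChartAt (mem_chart_source E x))
    rw [mvfderiv_congr (heq w)]
    -- Seeing `u` as the value at `x` of its own extension lets `mvfderiv_extend` apply a second
    -- time.
    conv_lhs => rw [← FiberBundle.extend_apply_self E u]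
    rw [mvfderiv_extend (mem_chart_source E x) hmd]
    have h2 : ((fun z => fderiv ℝ (f ∘ φ.symm) z (chartVec w)) ∘ φ) ∘ φ.symm =ᶠ[𝓝 (φ x)]
        fun z => fderiv ℝ (f ∘ φ.symm) z (chartVec w) := by
      filter_upwards [extChartAt_target_mem_nhds (I := 𝓘(ℝ, E)) x] with z hz
      simp only [Function.comp_apply]
      rw [φ.right_inv hz]
    rw [h2.fderiv_eq, fderiv_clm_apply hdF (differentiableAt_const _)]
    simp
  -- The bracket term vanishes; the other two cancel by symmetry of the second derivative.
  rw [dForm, mlieBracket_extend, key, key]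
  have hsymm := hF.isSymmSndFDerivAt (by simpa using h2)
  rw [hsymm.eq]
  simp

/-- The function of an exact one-form is smooth. -/
lemma isSmoothForm_mvfderiv {f : P → ℝ}
    (hf : ContMDiff 𝓘(ℝ, E) 𝓘(ℝ, ℝ) ∞ f) : IsSmoothForm (mvfderiv 𝓘(ℝ, E) f) := by
  -- The function of `df` is the fibre component of the tangent map `Tf : TP → Tℝ`.
  have h := hf.contMDiff_tangentMap (m := ∞) (by simp)
  exact (contMDiff_snd_tangentBundle_modelSpace (𝕜 := ℝ) (I := 𝓘(ℝ, ℝ))).comp h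

lemma mvfderiv_coordinate {x y : P} (hy : y ∈ (chartAt E x).source) (ℓ : E →L[ℝ] ℝ) :
    mvfderiv 𝓘(ℝ, E) (fun y => ℓ (extChartAt 𝓘(ℝ, E) x y)) y =
      ℓ.comp ((trivializationAt E (TangentSpace 𝓘(ℝ, E) : P → Type _) x).continuousLinearMapAt
        ℝ y) := by
  rw [TangentBundle.continuousLinearMapAt_trivializationAt hy]
  have h : MDifferentiableAt 𝓘(ℝ, E) 𝓘(ℝ, E) (extChartAt 𝓘(ℝ, E) x) y :=
    mdifferentiableAt_extChartAt hy
  ext u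
  have := mfderiv_comp_apply y ℓ.mdifferentiableAt h u
  rw [ContinuousLinearMap.mfderiv_eq] at this
  exact this

end Fields

/-! ### Global functions extending germs of coordinates. -/

section Coordinates

variable {E : Type*} [NormedAddCommGroup E] [NormedSpace ℝ E] [FiniteDimensional ℝ E]
  {P : Type*} [TopologicalSpace P] [ChartedSpace E P] [IsManifold 𝓘(ℝ, E) ∞ P] [T2Space P]

/-- The defining equations and the Poisson condition only speak of global functions, so coordinates
are cut off by a bump function; Hausdorffness makes the result smooth. -/
lemma exists_coordinate (x : P) (ℓ : E →L[ℝ] ℝ) :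
    ∃ f : P → ℝ, ContMDiff 𝓘(ℝ, E) 𝓘(ℝ, ℝ) ∞ f ∧
      f =ᶠ[𝓝 x] fun y => ℓ (extChartAt 𝓘(ℝ, E) x y) := by
  obtain ⟨b⟩ : Nonempty (SmoothBumpFunction 𝓘(ℝ, E) x) := inferInstance
  refine ⟨fun y => b y • ℓ (extChartAt 𝓘(ℝ, E) x y),
    b.contMDiff_smul (ℓ.contMDiff.comp_contMDiffOn contMDiffOn_extChartAt), ?_⟩
  filter_upwards [b.eventuallyEq_one] with y hy
  simp [hy]

end Coordinates

/-! ### Chart frames and the components of a bivector field. -/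

section Frames

variable {E : Type*} [NormedAddCommGroup E] [NormedSpace ℝ E] [FiniteDimensional ℝ E]
  {P : Type*} [TopologicalSpace P] [ChartedSpace E P] [IsManifold 𝓘(ℝ, E) ∞ P]

lemma sum_coframe_smul_frame {x y : P} (hy : y ∈ (chartAt E x).source)
    (u : TangentSpace 𝓘(ℝ, E) y) : ∑ i, coframe x i y u • frame x i y = u := by
  have h := Trivialization.symmL_continuousLinearMapAt (R := ℝ)
    (trivializationAt E (TangentSpace 𝓘(ℝ, E) : P → Type _) x) hy u
  conv_rhs => rw [← h, ← (Module.finBasis ℝ E).sum_repr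
    ((trivializationAt E (TangentSpace 𝓘(ℝ, E) : P → Type _) x).continuousLinearMapAt ℝ y u)]
  rw [map_sum]
  simp only [map_smul]
  rfl

lemma frame_eq_extend {x y : P} (hy : y ∈ (chartAt E x).source) (i : Fin (Module.finrank ℝ E)) :
    frame x i y = FiberBundle.extend E (frame x i x) y := by
  rw [extend_apply hy, chartVec]
  exact congrArg (Trivialization.symmL ℝ
    (trivializationAt E (TangentSpace 𝓘(ℝ, E) : P → Type _) x) y)
    (Trivialization.continuousLinearMapAt_symmL (R := ℝ) _ (mem_chart_source E x) _).symm

lemma frame_eventuallyEq (x : P) (i : Fin (Module.finrank ℝ E)) :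
    ∀ᶠ y in 𝓝 x, frame x i y = FiberBundle.extend E (frame x i x) y := by
  filter_upwards [eventually_mem_source (E := E) x] with y hy using frame_eq_extend hy i

lemma mdifferentiableAt_frame (x : P) (i : Fin (Module.finrank ℝ E)) :
    MDifferentiableAt 𝓘(ℝ, E) 𝓘(ℝ, E).tangent
      (fun y => (⟨y, frame x i y⟩ : TangentBundle 𝓘(ℝ, E) P)) x := by
  refine (mdifferentiableAt_extend (frame x i x)).congr_of_eventuallyEq ?_
  filter_upwards [frame_eventuallyEq x i] with y hy
  rw [hy]

lemma eq_sum_component {x y : P} (hy : y ∈ (chartAt E x).source)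
    (η : ∀ x : P, TangentSpace 𝓘(ℝ, E) x ⊗[ℝ] TangentSpace 𝓘(ℝ, E) x) :
    η y = ∑ i, ∑ j, component η x i j y • (frame x i y ⊗ₜ[ℝ] frame x j y) :=
  eq_sum_pair _ _ (sum_coframe_smul_frame hy) (η y)

lemma component_swap {η : ∀ x : P, TangentSpace 𝓘(ℝ, E) x ⊗[ℝ] TangentSpace 𝓘(ℝ, E) x}
    (hη : ∀ x, IsBivector (η x)) (x : P) (i j : Fin (Module.finrank ℝ E)) (y : P) :
    component η x j i y = -component η x i j y :=
  (hη y).pair_swap _ _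

lemma mvfderiv_component_swap
    {η : ∀ x : P, TangentSpace 𝓘(ℝ, E) x ⊗[ℝ] TangentSpace 𝓘(ℝ, E) x}
    (hη : ∀ x, IsBivector (η x)) (x : P) (i j : Fin (Module.finrank ℝ E)) :
    mvfderiv 𝓘(ℝ, E) (component η x j i) x = -mvfderiv 𝓘(ℝ, E) (component η x i j) x := by
  rw [← mvfderiv_neg]
  congr 1
  funext y
  exact component_swap hη x i j y

variable [T2Space P]

lemma exists_coordinate_coframe (x : P) (i : Fin (Module.finrank ℝ E)) :
    ∃ f : P → ℝ, ContMDiff 𝓘(ℝ, E) 𝓘(ℝ, ℝ) ∞ f ∧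
      f =ᶠ[𝓝 x] (fun y => (Module.finBasis ℝ E).coord i (extChartAt 𝓘(ℝ, E) x y)) ∧
      ∀ᶠ y in 𝓝 x, mvfderiv 𝓘(ℝ, E) f y = coframe x i y := by
  obtain ⟨f, hf, hfx⟩ := exists_coordinate x
    (LinearMap.toContinuousLinearMap ((Module.finBasis ℝ E).coord i))
  refine ⟨f, hf, hfx, ?_⟩
  filter_upwards [hfx.eventuallyEq_nhds, eventually_mem_source (E := E) x] with y hy hys
  rw [mvfderiv_congr hy, mvfderiv_coordinate hys]
  rfl

/-- Smoothness of `η` is given only through brackets. Near `x` the component is the bracket of two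
cut-off coordinates, whose differentials equal the coframe on a whole neighbourhood. -/
lemma mdifferentiableAt_component
    {η : ∀ x : P, TangentSpace 𝓘(ℝ, E) x ⊗[ℝ] TangentSpace 𝓘(ℝ, E) x}
    (hη : IsPoisson 𝓘(ℝ, E) η) (x : P) (i j : Fin (Module.finrank ℝ E)) :
    MDifferentiableAt 𝓘(ℝ, E) 𝓘(ℝ, ℝ) (component η x i j) x := by
  obtain ⟨f, hf, -, hf'⟩ := exists_coordinate_coframe (E := E) x i
  obtain ⟨g, hg, -, hg'⟩ := exists_coordinate_coframe (E := E) x j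
  refine ((hη.smooth f g hf hg x).mdifferentiableAt (by simp)).congr_of_eventuallyEq ?_
  filter_upwards [hf', hg'] with y hfy hgy
  rw [bracket, (hη.isBivector y).wedgePair_eq, hfy, hgy, component]

end Frames

/-! ### Lie brackets of combinations of commuting fields. -/

section Lie

variable {E : Type*} [NormedAddCommGroup E] [NormedSpace ℝ E] [CompleteSpace E]
  {P : Type*} [TopologicalSpace P] [ChartedSpace E P] [IsManifold 𝓘(ℝ, E) ∞ P]

/-- In `[fX, U] = f[X, U] - U(f)X` only the second term survives. -/
lemma mlieBracket_sum_smul {ι : Type*} (s : Finset ι) {x : P} (f : ι → P → ℝ)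
    (X : ι → ∀ y : P, TangentSpace 𝓘(ℝ, E) y) (U : ∀ y : P, TangentSpace 𝓘(ℝ, E) y)
    (hf : ∀ i, MDifferentiableAt 𝓘(ℝ, E) 𝓘(ℝ, ℝ) (f i) x)
    (hX : ∀ i, MDifferentiableAt 𝓘(ℝ, E) 𝓘(ℝ, E).tangent
      (fun y => (⟨y, X i y⟩ : TangentBundle 𝓘(ℝ, E) P)) x)
    (hXU : ∀ i, VectorField.mlieBracket 𝓘(ℝ, E) (X i) U x = 0) :
    VectorField.mlieBracket 𝓘(ℝ, E) (∑ i ∈ s, f i • X i) U x =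
      -∑ i ∈ s, mvfderiv 𝓘(ℝ, E) (f i) x (U x) • X i x := by
  classical
  have hd (i : ι) : MDifferentiableAt 𝓘(ℝ, E) 𝓘(ℝ, E).tangent
      (fun y => (⟨y, (f i • X i) y⟩ : TangentBundle 𝓘(ℝ, E) P)) x :=
    (hf i).smul_section (hX i)
  have hs (s : Finset ι) : MDifferentiableAt 𝓘(ℝ, E) 𝓘(ℝ, E).tangent
      (fun y => (⟨y, (∑ i ∈ s, f i • X i) y⟩ : TangentBundle 𝓘(ℝ, E) P)) x := by
    simpa only [Finset.sum_apply] using MDifferentiableAt.sum_section (s := s) fun i _ => hd i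
  induction s using Finset.induction_on with
  | empty => simp
  | insert i s his ih =>
    rw [Finset.sum_insert his, VectorField.mlieBracket_add_left (hd i) (hs s), ih,
      VectorField.mlieBracket_smul_left (hf i) (hX i), hXU, Finset.sum_insert his]
    simp only [smul_zero, add_zero, neg_smul, neg_add]

end Lie

/-! ### Derivatives along vertical and chart lifts. -/

section Lifts

variable {E : Type*} [NormedAddCommGroup E] [NormedSpace ℝ E]
  {P : Type*} [TopologicalSpace P] [ChartedSpace E P] [IsManifold 𝓘(ℝ, E) ∞ P]

lemma mdifferentiableAt_fiber_inclusion (x : P) (w : E) :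
    MDifferentiableAt 𝓘(ℝ, E) 𝓘(ℝ, E).tangent
      (fun w : E => (⟨x, w⟩ : TangentBundle 𝓘(ℝ, E) P)) w := by
  refine (mdifferentiableAt_totalSpace 𝓘(ℝ, E) _).2 ⟨mdifferentiableAt_const, ?_⟩
  -- In the trivialization centred at `x` itself, the coordinate change on the fibre over `x` is the
  -- identity.
  have h : (fun w : E => ((trivializationAt E (TangentSpace 𝓘(ℝ, E) : P → Type _) x)
      (⟨x, w⟩ : TangentBundle 𝓘(ℝ, E) P)).2) = fun w => w := by
    funext w
    rw [TangentBundle.trivializationAt_apply]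
    exact tangentCoordChange_self (I := 𝓘(ℝ, E)) (mem_extChartAt_source x)
  exact h ▸ mdifferentiableAt_id

lemma mvfderiv_verticalLift {h : TangentBundle 𝓘(ℝ, E) P → ℝ} {v : TangentBundle 𝓘(ℝ, E) P}
    (hh : MDifferentiableAt 𝓘(ℝ, E).tangent 𝓘(ℝ, ℝ) h v) (u : TangentSpace 𝓘(ℝ, E) v.proj) :
    mvfderiv 𝓘(ℝ, E).tangent h v (verticalLift v u) =
      fderiv ℝ (fun w : E => h ⟨v.proj, w⟩) v.snd u := by
  have := mvfderiv_comp_apply (I := 𝓘(ℝ, E).tangent) (I' := 𝓘(ℝ, E)) (g := h)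
    (f := fun w : E => (⟨v.proj, w⟩ : TangentBundle 𝓘(ℝ, E) P)) v.snd hh
    (mdifferentiableAt_fiber_inclusion (E := E) v.proj v.snd) u
  rw [verticalLift]
  refine this.symm.trans ?_
  exact congrArg (fun L : E →L[ℝ] ℝ => L u) mfderiv_eq_fderiv

lemma mvfderiv_chartLift {h : TangentBundle 𝓘(ℝ, E) P → ℝ} {v : TangentBundle 𝓘(ℝ, E) P}
    (hh : MDifferentiableAt 𝓘(ℝ, E).tangent 𝓘(ℝ, ℝ) h v) (u : TangentSpace 𝓘(ℝ, E) v.proj) :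
    mvfderiv 𝓘(ℝ, E).tangent h v (chartLift v u) =
      mvfderiv 𝓘(ℝ, E) (fun y => h ⟨y, FiberBundle.extend E v.snd y⟩) v.proj u :=
  (mvfderiv_comp_apply_of_eq (I := 𝓘(ℝ, E).tangent) (I' := 𝓘(ℝ, E)) v.proj hh
    (mdifferentiableAt_extend v.snd) (by simp) u).symm

lemma mdifferentiableAt_proj (v : TangentBundle 𝓘(ℝ, E) P) :
    MDifferentiableAt 𝓘(ℝ, E).tangent 𝓘(ℝ, E)
      (fun w : TangentBundle 𝓘(ℝ, E) P => w.proj) v :=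
  Bundle.mdifferentiableAt_proj _

variable {f : P → ℝ} {v : TangentBundle 𝓘(ℝ, E) P}

lemma mvfderiv_comp_proj_verticalLift
    (hf : MDifferentiableAt 𝓘(ℝ, E) 𝓘(ℝ, ℝ) f v.proj) (u : TangentSpace 𝓘(ℝ, E) v.proj) :
    mvfderiv 𝓘(ℝ, E).tangent (fun w : TangentBundle 𝓘(ℝ, E) P => f w.proj) v
      (verticalLift v u) = 0 := by
  refine (mvfderiv_verticalLift (h := fun w : TangentBundle 𝓘(ℝ, E) P => f w.proj)
    (hf.comp v (mdifferentiableAt_proj v)) u).trans ?_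
  exact congrArg (fun L : E →L[ℝ] ℝ => L u)
    (hasFDerivAt_const (𝕜 := ℝ) (f v.proj) (show E from v.snd)).fderiv

lemma mvfderiv_comp_proj_chartLift
    (hf : MDifferentiableAt 𝓘(ℝ, E) 𝓘(ℝ, ℝ) f v.proj) (u : TangentSpace 𝓘(ℝ, E) v.proj) :
    mvfderiv 𝓘(ℝ, E).tangent (fun w : TangentBundle 𝓘(ℝ, E) P => f w.proj) v
      (chartLift v u) = mvfderiv 𝓘(ℝ, E) f v.proj u :=
  mvfderiv_chartLift (h := fun w : TangentBundle 𝓘(ℝ, E) P => f w.proj)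
    (hf.comp v (mdifferentiableAt_proj v)) u

variable {α : ∀ x : P, TangentSpace 𝓘(ℝ, E) x →L[ℝ] ℝ}

lemma mvfderiv_tildeForm_verticalLift (hα : IsSmoothForm α)
    (u : TangentSpace 𝓘(ℝ, E) v.proj) :
    mvfderiv 𝓘(ℝ, E).tangent (tildeForm α) v (verticalLift v u) = α v.proj u := by
  rw [mvfderiv_verticalLift ((hα v).mdifferentiableAt (by simp))]
  exact congrArg (fun L : E →L[ℝ] ℝ => L u)
    (ContinuousLinearMap.fderiv (show E →L[ℝ] ℝ from α v.proj))

lemma mvfderiv_tildeForm_chartLift (hα : IsSmoothForm α)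
    (u : TangentSpace 𝓘(ℝ, E) v.proj) :
    mvfderiv 𝓘(ℝ, E).tangent (tildeForm α) v (chartLift v u) =
      mvfderiv 𝓘(ℝ, E) (fun y => α y (FiberBundle.extend E v.snd y)) v.proj u :=
  mvfderiv_chartLift ((hα v).mdifferentiableAt (by simp)) u

lemma IsSmoothForm.mdifferentiableAt_apply (hα : IsSmoothForm α) {x : P}
    {X : ∀ y : P, TangentSpace 𝓘(ℝ, E) y}
    (hX : MDifferentiableAt 𝓘(ℝ, E) 𝓘(ℝ, E).tangent
      (fun y => (⟨y, X y⟩ : TangentBundle 𝓘(ℝ, E) P)) x) :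
    MDifferentiableAt 𝓘(ℝ, E) 𝓘(ℝ, ℝ) (fun y => α y (X y)) x :=
  ((hα ⟨x, X x⟩).mdifferentiableAt (by simp)).comp x hX

end Lifts

/-! ### The bracket of one-forms in a chart. -/

section FormBracket

variable {E : Type*} [NormedAddCommGroup E] [NormedSpace ℝ E] [FiniteDimensional ℝ E]
  {P : Type*} [TopologicalSpace P] [ChartedSpace E P] [IsManifold 𝓘(ℝ, E) ∞ P]
  {η : ∀ x : P, TangentSpace 𝓘(ℝ, E) x ⊗[ℝ] TangentSpace 𝓘(ℝ, E) x}
  {α β : ∀ x : P, TangentSpace 𝓘(ℝ, E) x →L[ℝ] ℝ}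

omit [FiniteDimensional ℝ E] [IsManifold 𝓘(ℝ, E) ∞ P] in
lemma mlieBracket_congr_left {V V' U : ∀ y : P, TangentSpace 𝓘(ℝ, E) y} {x : P}
    (h : ∀ᶠ y in 𝓝 x, V y = V' y) :
    VectorField.mlieBracket 𝓘(ℝ, E) V U x = VectorField.mlieBracket 𝓘(ℝ, E) V' U x :=
  Filter.EventuallyEq.mlieBracket_vectorField_eq h (EventuallyEq.refl _ _)

lemma sharp_eq_sum {x y : P} (hy : y ∈ (chartAt E x).source)
    (a : TangentSpace 𝓘(ℝ, E) y →L[ℝ] ℝ) :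
    sharp (η y) a = ∑ i, ∑ j, (component η x i j y * a (frame x i y)) • frame x j y := by
  conv_lhs => rw [eq_sum_component hy η]
  exact sharp_sum_tmul _ _ _

lemma pair_eq_sum {x y : P} (hy : y ∈ (chartAt E x).source)
    (a b : TangentSpace 𝓘(ℝ, E) y →L[ℝ] ℝ) :
    pair (η y) a b =
      ∑ i, ∑ j, component η x i j y * a (frame x i y) * b (frame x j y) := by
  conv_lhs => rw [eq_sum_component hy η]
  simp [mul_assoc]

omit [FiniteDimensional ℝ E] [IsManifold 𝓘(ℝ, E) ∞ P] in
lemma mdifferentiableAt_fun_sum {ι : Type*} (s : Finset ι) {f : ι → P → ℝ} {x : P}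
    (hf : ∀ i, MDifferentiableAt 𝓘(ℝ, E) 𝓘(ℝ, ℝ) (f i) x) :
    MDifferentiableAt 𝓘(ℝ, E) 𝓘(ℝ, ℝ) (fun y => ∑ i ∈ s, f i y) x := by
  classical
  induction s using Finset.induction_on with
  | empty => simpa only [Finset.sum_empty] using mdifferentiableAt_const
  | insert i s his ih =>
    simp only [Finset.sum_insert his]
    exact (hf i).add ih

omit [FiniteDimensional ℝ E] [IsManifold 𝓘(ℝ, E) ∞ P] in
lemma mvfderiv_fun_sum {ι : Type*} (s : Finset ι) {f : ι → P → ℝ} {x : P}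
    (hf : ∀ i, MDifferentiableAt 𝓘(ℝ, E) 𝓘(ℝ, ℝ) (f i) x) (u : TangentSpace 𝓘(ℝ, E) x) :
    mvfderiv 𝓘(ℝ, E) (fun y => ∑ i ∈ s, f i y) x u = ∑ i ∈ s, mvfderiv 𝓘(ℝ, E) (f i) x u := by
  classical
  induction s using Finset.induction_on with
  | empty => simp only [Finset.sum_empty, mvfderiv_const, zero_apply]
  | insert i s his ih =>
    simp only [Finset.sum_insert his]
    rw [mvfderiv_fun_add (hf i) (mdifferentiableAt_fun_sum s hf), add_apply, ih]

variable [T2Space P]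

/-- Expand `η(α) = ∑ η^{ij} α(e_i) e_j`. As each `e_j` commutes at `x` with the extension `U` of
`u`, `[η(α), U]` only involves the derivatives of the coefficients along `u`. -/
lemma lieDerivForm_sharp [CompleteSpace E] (hη : IsPoisson 𝓘(ℝ, E) η)
    (hα : IsSmoothForm α) (x : P) (u : TangentSpace 𝓘(ℝ, E) x) :
    lieDerivForm (fun y => sharp (η y) (α y)) β x u =
      ∑ i, ∑ j, (component η x i j x * α x (frame x i x) *
          mvfderiv 𝓘(ℝ, E) (fun y => β y (FiberBundle.extend E u y)) x (frame x j x) +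
        (component η x i j x * mvfderiv 𝓘(ℝ, E) (fun y => α y (frame x i y)) x u +
          mvfderiv 𝓘(ℝ, E) (component η x i j) x u * α x (frame x i x)) *
            β x (frame x j x)) := by
  have hc (i j) := mdifferentiableAt_component hη x i j
  have ha (i) := hα.mdifferentiableAt_apply (mdifferentiableAt_frame x i)
  let U : ∀ y : P, TangentSpace 𝓘(ℝ, E) y := FiberBundle.extend E u
  have hX : VectorField.mlieBracket 𝓘(ℝ, E) (fun y => sharp (η y) (α y)) U x =
      VectorField.mlieBracket 𝓘(ℝ, E)
        (∑ p : Fin (Module.finrank ℝ E) × Fin (Module.finrank ℝ E),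
          (fun y => component η x p.1 p.2 y * α y (frame x p.1 y)) •
            (FiberBundle.extend E (frame x p.2 x) : ∀ y : P, TangentSpace 𝓘(ℝ, E) y)) U x := by
    refine mlieBracket_congr_left ?_
    filter_upwards [eventually_mem_source (E := E) x] with y hy
    rw [sharp_eq_sum hy, ← Fintype.sum_prod_type']
    simp only [Finset.sum_apply, Pi.smul_apply', frame_eq_extend hy]
  have hca (p : Fin (Module.finrank ℝ E) × Fin (Module.finrank ℝ E)) :
      MDifferentiableAt 𝓘(ℝ, E) 𝓘(ℝ, ℝ)
        (fun y => component η x p.1 p.2 y * α y (frame x p.1 y)) x :=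
    (hc p.1 p.2).mul (ha p.1)
  have hsum := mlieBracket_sum_smul Finset.univ
    (fun (p : Fin (Module.finrank ℝ E) × Fin (Module.finrank ℝ E)) y =>
      component η x p.1 p.2 y * α y (frame x p.1 y))
    (fun p => (FiberBundle.extend E (frame x p.2 x) : ∀ y : P, TangentSpace 𝓘(ℝ, E) y)) U
    hca (fun p => mdifferentiableAt_extend (frame x p.2 x))
    (fun p => mlieBracket_extend (frame x p.2 x) u)
  have h1 (L : TangentSpace 𝓘(ℝ, E) x →L[ℝ] ℝ) : L (sharp (η x) (α x)) =
      ∑ i, ∑ j, component η x i j x * α x (frame x i x) * L (frame x j x) := by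
    rw [sharp_eq_sum (mem_chart_source E x)]
    simp only [map_sum, map_smul, smul_eq_mul]
  have h2 (L : TangentSpace 𝓘(ℝ, E) x →L[ℝ] ℝ) :
      L (VectorField.mlieBracket 𝓘(ℝ, E) (fun y => sharp (η y) (α y)) U x) =
      -∑ i, ∑ j, (component η x i j x * mvfderiv 𝓘(ℝ, E) (fun y => α y (frame x i y)) x u +
        mvfderiv 𝓘(ℝ, E) (component η x i j) x u * α x (frame x i x)) * L (frame x j x) := by
    rw [hX, hsum, map_neg, map_sum, Fintype.sum_prod_type]
    refine congrArg Neg.neg (Finset.sum_congr rfl fun i _ => Finset.sum_congr rfl fun j _ => ?_)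
    rw [map_smul, mvfderiv_fun_mul (hc i j) (ha i)]
    simp only [U, FiberBundle.extend_apply_self, add_apply, smul_apply, smul_eq_mul]
    ring
  rw [lieDerivForm, h1, h2, sub_neg_eq_add, ← Finset.sum_add_distrib]
  exact Finset.sum_congr rfl fun i _ => Finset.sum_add_distrib.symm

/-- The bracket of one-forms in the chart at `x`. -/
lemma formBracket_eq_sum [CompleteSpace E] (hη : IsPoisson 𝓘(ℝ, E) η)
    (hα : IsSmoothForm α) (hβ : IsSmoothForm β) (x : P) (u : TangentSpace 𝓘(ℝ, E) x) :
    formBracket η α β x u =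
      ∑ i, ∑ j, (mvfderiv 𝓘(ℝ, E) (component η x i j) x u *
          (α x (frame x i x) * β x (frame x j x)) +
        component η x i j x * (α x (frame x i x) *
          mvfderiv 𝓘(ℝ, E) (fun y => β y (FiberBundle.extend E u y)) x (frame x j x) +
          mvfderiv 𝓘(ℝ, E) (fun y => α y (FiberBundle.extend E u y)) x (frame x i x) *
            β x (frame x j x))) := by
  have hc (i j) := mdifferentiableAt_component hη x i j
  have ha (i) := hα.mdifferentiableAt_apply (mdifferentiableAt_frame x i)
  have hb (i) := hβ.mdifferentiableAt_apply (mdifferentiableAt_frame x i)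
  have hp : (fun y => wedgePair (η y) (α y) (β y)) =ᶠ[𝓝 x] fun y => ∑ i, ∑ j,
      component η x i j y * α y (frame x i y) * β y (frame x j y) := by
    filter_upwards [eventually_mem_source (E := E) x] with y hy
    rw [(hη.isBivector y).wedgePair_eq, pair_eq_sum hy]
  have hca (i j) : MDifferentiableAt 𝓘(ℝ, E) 𝓘(ℝ, ℝ)
      (fun y => component η x i j y * α y (frame x i y)) x := (hc i j).mul (ha i)
  have hd (i j) : MDifferentiableAt 𝓘(ℝ, E) 𝓘(ℝ, ℝ)
      (fun y => component η x i j y * α y (frame x i y) * β y (frame x j y)) x :=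
    (hca i j).mul (hb j)
  rw [formBracket, lieDerivForm_sharp hη hα, lieDerivForm_sharp hη hβ, mvfderiv_congr hp,
    mvfderiv_fun_sum _ (fun i => mdifferentiableAt_fun_sum _ (hd i))]
  -- Exchanging the indices in `L_{η(β)} α` aligns it with the other sums, up to the sign in `η^{ji}
  -- = -η^{ij}`.
  conv_lhs =>
    enter [1, 2]
    rw [Finset.sum_comm]
  rw [← Finset.sum_sub_distrib, ← Finset.sum_sub_distrib]
  refine Finset.sum_congr rfl fun i _ => ?_
  rw [mvfderiv_fun_sum _ (hd i), ← Finset.sum_sub_distrib, ← Finset.sum_sub_distrib]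
  refine Finset.sum_congr rfl fun j _ => ?_
  -- The Lie derivatives yield `u(η^{ij}) α_i β_j` twice, and the terms with `u(α_i)` and `u(β_j)`
  -- once each. Subtracting `u(η^{ij} α_i β_j)` leaves one copy of the first and none of the others.
  rw [mvfderiv_fun_mul (hca i j) (hb j), mvfderiv_fun_mul (hc i j) (ha i),
    mvfderiv_component_swap hη.isBivector x i j, component_swap hη.isBivector x i j]
  simp only [add_apply, smul_apply,
    neg_apply, smul_eq_mul]
  ring

end FormBracket

/-! ### Existence and uniqueness of the bivector field on `TP`. -/

section Existence

variable {E : Type*} [NormedAddCommGroup E] [NormedSpace ℝ E] [FiniteDimensional ℝ E]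
  {P : Type*} [TopologicalSpace P] [ChartedSpace E P] [IsManifold 𝓘(ℝ, E) ∞ P]
  {η : ∀ x : P, TangentSpace 𝓘(ℝ, E) x ⊗[ℝ] TangentSpace 𝓘(ℝ, E) x}

/-- Flipping the factors and exchanging `i` and `j` preserves the tensor expressions, while `η^{ij}`
and its derivative change sign. -/
lemma isBivector_tangentPoisson (hη : ∀ x, IsBivector (η x)) (v : TangentBundle 𝓘(ℝ, E) P) :
    IsBivector (tangentPoisson η v) := by
  rw [IsBivector, tangentPoisson, map_sum, Finset.sum_congr rfl fun i _ => map_sum _ _ _,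
    Finset.sum_comm, ← Finset.sum_neg_distrib]
  refine Finset.sum_congr rfl fun i _ => ?_
  rw [← Finset.sum_neg_distrib]
  refine Finset.sum_congr rfl fun j _ => ?_
  rw [mvfderiv_component_swap hη v.proj i j, component_swap hη v.proj i j]
  simp only [map_add, map_neg, map_smul, TensorProduct.comm_tmul, neg_apply, neg_smul]
  module

lemma pair_tangentPoisson (v : TangentBundle 𝓘(ℝ, E) P)
    (a b : TangentSpace 𝓘(ℝ, E).tangent v →L[ℝ] ℝ) :
    pair (tangentPoisson η v) a b =
      ∑ i, ∑ j, (mvfderiv 𝓘(ℝ, E) (component η v.proj i j) v.proj v.snd *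
        (a (verticalLift v (frame v.proj i v.proj)) *
          b (verticalLift v (frame v.proj j v.proj))) +
        component η v.proj i j v.proj *
          (a (verticalLift v (frame v.proj i v.proj)) * b (chartLift v (frame v.proj j v.proj)) +
          a (chartLift v (frame v.proj i v.proj)) *
            b (verticalLift v (frame v.proj j v.proj)))) := by
  simp only [tangentPoisson, pair_sum, pair_add, pair_smul, pair_tmul, smul_eq_mul]

variable [T2Space P] [CompleteSpace E]

/-- Differentials of `p^*f` kill vertical lifts, and `α~` is linear on fibres. With these values the
pairing of two forms matches `formBracket_eq_sum` term by term. -/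
lemma isTangentPoisson_tangentPoisson (hη : IsPoisson 𝓘(ℝ, E) η) :
    IsTangentPoisson η (tangentPoisson η) := by
  have hb := isBivector_tangentPoisson hη.isBivector
  refine ⟨hb, ?_, ?_, ?_⟩
  · intro α β hα _ hβ _ v
    rw [bracket, (hb v).wedgePair_eq, pair_tangentPoisson, formBracket_eq_sum hη hα hβ]
    simp only [mvfderiv_tildeForm_verticalLift hα, mvfderiv_tildeForm_verticalLift hβ,
      mvfderiv_tildeForm_chartLift hα, mvfderiv_tildeForm_chartLift hβ]
  · intro f g hf hg v
    rw [bracket, (hb v).wedgePair_eq, pair_tangentPoisson]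
    have hf' := (hf v.proj).mdifferentiableAt (by simp)
    have hg' := (hg v.proj).mdifferentiableAt (by simp)
    simp only [mvfderiv_comp_proj_verticalLift hf', mvfderiv_comp_proj_verticalLift hg']
    simp
  · intro α f hα _ hf v
    have hf' := (hf v.proj).mdifferentiableAt (by simp)
    rw [bracket, (hb v).wedgePair_eq, pair_tangentPoisson,
      apply_sharp, pair_eq_sum (mem_chart_source E v.proj)]
    simp only [mvfderiv_comp_proj_verticalLift hf', mvfderiv_comp_proj_chartLift hf',
      mvfderiv_tildeForm_verticalLift hα]
    simp [mul_assoc]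

/-- A bivector field on `TP` is determined by the three defining equations. -/
lemma IsTangentPoisson.eq {Pi Pi' : ∀ v : TangentBundle 𝓘(ℝ, E) P,
    TangentSpace 𝓘(ℝ, E).tangent v ⊗[ℝ] TangentSpace 𝓘(ℝ, E).tangent v}
    (h : IsTangentPoisson η Pi) (h' : IsTangentPoisson η Pi') : Pi = Pi' := by
  funext v
  choose f hf hfx hdf using exists_coordinate_coframe (E := E) v.proj
  have hα (i) := isSmoothForm_mvfderiv (hf i)
  have hα' (i) := isClosedForm_mvfderiv (hf i)
  have hproj : Tendsto (fun w : TangentBundle 𝓘(ℝ, E) P => w.proj) (𝓝 v) (𝓝 v.proj) :=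
    (mdifferentiableAt_proj v).continuousAt
  -- These are `dx^i` and `dv^i` at `v`: near `v`, `f i` composed with the projection and the
  -- function of `d(f i)` are the base and fibre coordinates of the chart of `TP`.
  let s : Fin (Module.finrank ℝ E) ⊕ Fin (Module.finrank ℝ E) →
      TangentSpace 𝓘(ℝ, E).tangent v →L[ℝ] ℝ :=
    Sum.elim (fun i => mvfderiv 𝓘(ℝ, E).tangent
        (fun w : TangentBundle 𝓘(ℝ, E) P => f i w.proj) v)
      (fun i => mvfderiv 𝓘(ℝ, E).tangent (tildeForm (mvfderiv 𝓘(ℝ, E) (f i))) v)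
  refine ext_pair s (fun u hu => ?_) ?_
  · let c (i) : E →L[ℝ] ℝ := LinearMap.toContinuousLinearMap ((Module.finBasis ℝ E).coord i)
    have hz (z : E) (h : ∀ i, c i z = 0) : z = 0 :=
      (Module.finBasis ℝ E).forall_coord_eq_zero_iff.1 h
    have h1 (i) : c i (show E × E from u).1 = 0 := by
      have h := mvfderiv_clm_extChartAt (I := 𝓘(ℝ, E).tangent)
        ((c i).comp (ContinuousLinearMap.fst ℝ E E)) v u
      refine h.symm.trans (Eq.trans ?_ (hu (Sum.inl i)))
      refine congrArg (fun L : TangentSpace 𝓘(ℝ, E).tangent v →L[ℝ] ℝ => L u)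
        (mvfderiv_congr ?_)
      filter_upwards [hproj.eventually (hfx i)] with w hw
      rw [hw]
      rfl
    have h2 (i) : c i (show E × E from u).2 = 0 := by
      have h := mvfderiv_clm_extChartAt (I := 𝓘(ℝ, E).tangent)
        ((c i).comp (ContinuousLinearMap.snd ℝ E E)) v u
      refine h.symm.trans (Eq.trans ?_ (hu (Sum.inr i)))
      refine congrArg (fun L : TangentSpace 𝓘(ℝ, E).tangent v →L[ℝ] ℝ => L u)
        (mvfderiv_congr ?_)
      filter_upwards [hproj.eventually (hdf i),
        hproj.eventually (eventually_mem_source (E := E) v.proj)] with w hw hws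
      have ht : (trivializationAt E (TangentSpace 𝓘(ℝ, E) : P → Type _)
          v.proj).continuousLinearMapAt ℝ w.proj w.snd =
          ((trivializationAt E (TangentSpace 𝓘(ℝ, E) : P → Type _) v.proj) w).2 := by
        rw [Trivialization.continuousLinearMapAt_apply, Trivialization.linearMapAt_apply]
        exact if_pos hws
      rw [tildeForm, hw]
      exact congrArg (c i) ht.symm
    exact Prod.ext (hz _ h1) (hz _ h2)
  · have key {f g : TangentBundle 𝓘(ℝ, E) P → ℝ}
        (hfg : bracket 𝓘(ℝ, E).tangent Pi f g v = bracket 𝓘(ℝ, E).tangent Pi' f g v) :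
        pair (Pi v) (mvfderiv 𝓘(ℝ, E).tangent f v) (mvfderiv 𝓘(ℝ, E).tangent g v) =
          pair (Pi' v) (mvfderiv 𝓘(ℝ, E).tangent f v) (mvfderiv 𝓘(ℝ, E).tangent g v) := by
      rwa [bracket, bracket, (h.isBivector v).wedgePair_eq, (h'.isBivector v).wedgePair_eq]
        at hfg
    have hmix (i j) := key ((h.form_fun _ (f j) (hα i) (hα' i) (hf j) v).trans
      (h'.form_fun _ (f j) (hα i) (hα' i) (hf j) v).symm)
    rintro (i | i) (j | j)
    · exact key ((h.fun_fun _ _ (hf i) (hf j) v).trans (h'.fun_fun _ _ (hf i) (hf j) v).symm)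
    -- The equations give the mixed pairing in one order only; antisymmetry supplies the other.
    · rw [(h.isBivector v).pair_swap (s (Sum.inr j)), (h'.isBivector v).pair_swap (s (Sum.inr j))]
      exact congrArg Neg.neg (hmix j i)
    · exact hmix i j
    · exact key ((h.form_form _ _ (hα i) (hα' i) (hα j) (hα' j) v).trans
        (h'.form_form _ _ (hα i) (hα' i) (hα j) (hα' j) v).symm)

lemma isTangentPoisson_iff (hη : IsPoisson 𝓘(ℝ, E) η)
    (Pi : ∀ v : TangentBundle 𝓘(ℝ, E) P,
      TangentSpace 𝓘(ℝ, E).tangent v ⊗[ℝ] TangentSpace 𝓘(ℝ, E).tangent v) :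
    IsTangentPoisson η Pi ↔ Pi = tangentPoisson η :=
  ⟨fun h => h.eq (isTangentPoisson_tangentPoisson hη),
    fun h => h ▸ isTangentPoisson_tangentPoisson hη⟩

end Existence

/-! ### The connection form of the bivector, and maps `TP → P`. -/

section Maps

variable {E : Type*} [NormedAddCommGroup E] [NormedSpace ℝ E] [FiniteDimensional ℝ E]
  [CompleteSpace E]
  {P : Type*} [TopologicalSpace P] [ChartedSpace E P] [IsManifold 𝓘(ℝ, E) ∞ P]
  {η : ∀ x : P, TangentSpace 𝓘(ℝ, E) x ⊗[ℝ] TangentSpace 𝓘(ℝ, E) x}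
  {cov : CovariantDerivative 𝓘(ℝ, E) E (TangentSpace 𝓘(ℝ, E) : P → Type _)}

/-- Vanishing torsion makes the difference of the two sides a Lie bracket of fields constant in the
chart, which is zero. This is where torsion-freeness enters. -/
lemma cov_frame_apply (htors : cov.torsion = 0) (v : TangentBundle 𝓘(ℝ, E) P)
    (i : Fin (Module.finrank ℝ E)) :
    cov (frame v.proj i) v.proj v.snd =
      cov (FiberBundle.extend E v.snd) v.proj (frame v.proj i v.proj) := by
  have h1 : cov (frame v.proj i) v.proj =
      cov (FiberBundle.extend E (frame v.proj i v.proj)) v.proj :=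
    (cov.isCovariantDerivativeOn (s := Set.univ)).congr_of_eventuallyEq
      (mdifferentiableAt_frame v.proj i) (mdifferentiableAt_extend _) univ_mem
      (frame_eventuallyEq v.proj i)
  have h2 := cov.torsion_eq_zero_iff.1 htors (mdifferentiableAt_extend v.snd)
    (mdifferentiableAt_extend (frame v.proj i v.proj))
  rw [mlieBracket_extend, sub_eq_zero, FiberBundle.extend_apply_self,
    FiberBundle.extend_apply_self] at h2
  rw [h1, h2]

/-- The bivector field of `TP` in terms of vertical and horizontal lifts. -/
lemma tangentPoisson_eq (htors : cov.torsion = 0) (v : TangentBundle 𝓘(ℝ, E) P) :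
    tangentPoisson η v =
      tensorMap (verticalLift v) (verticalLift v) (covDerivBivector cov η v) +
        symProd (verticalLift v) (horizontalLift cov v) (η v.proj) := by
  conv_rhs => rw [eq_sum_component (mem_chart_source E v.proj) η]
  rw [tangentPoisson, covDerivBivector, map_sum, map_sum, ← Finset.sum_add_distrib]
  refine Finset.sum_congr rfl fun i _ => ?_
  rw [map_sum, map_sum, ← Finset.sum_add_distrib]
  refine Finset.sum_congr rfl fun j _ => ?_
  -- Now the vertical corrections hidden in the horizontal lifts are exactly those of the Leibniz
  -- rule for `∇_v η`, with opposite sign.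
  rw [cov_frame_apply htors, cov_frame_apply htors]
  simp only [map_add, map_smul, symProd, LinearMap.add_apply, tensorMap_tmul, horizontalLift,
    sub_apply, ContinuousLinearMap.comp_apply, TensorProduct.tmul_sub, TensorProduct.sub_tmul]
  module

/-- The image of the bivector field of `TP` under a map `TP → P`. -/
lemma tensorMap_tangentPoisson (htors : cov.torsion = 0) (φ : TangentBundle 𝓘(ℝ, E) P → P)
    (v : TangentBundle 𝓘(ℝ, E) P) :
    tensorMap (mfderiv 𝓘(ℝ, E).tangent 𝓘(ℝ, E) φ v) (mfderiv 𝓘(ℝ, E).tangent 𝓘(ℝ, E) φ v)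
        (tangentPoisson η v) =
      tensorMap (vertDeriv φ v) (vertDeriv φ v) (covDerivBivector cov η v) +
        symProd (vertDeriv φ v) (horDeriv cov φ v) (η v.proj) := by
  rw [tangentPoisson_eq htors]
  simp only [map_add, symProd, LinearMap.add_apply, vertDeriv, horDeriv, tensorMap_comp]

omit [FiniteDimensional ℝ E] [CompleteSpace E] in
lemma bracket_comp {𝕜 : Type*} [RCLike 𝕜]
    (Pi : ∀ v : TangentBundle 𝓘(ℝ, E) P,
      TangentSpace 𝓘(ℝ, E).tangent v ⊗[ℝ] TangentSpace 𝓘(ℝ, E).tangent v)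
    {φ : TangentBundle 𝓘(ℝ, E) P → P} {f g : P → 𝕜} {v : TangentBundle 𝓘(ℝ, E) P}
    (hφ : MDifferentiableAt 𝓘(ℝ, E).tangent 𝓘(ℝ, E) φ v)
    (hf : MDifferentiableAt 𝓘(ℝ, E) 𝓘(ℝ, 𝕜) f (φ v))
    (hg : MDifferentiableAt 𝓘(ℝ, E) 𝓘(ℝ, 𝕜) g (φ v)) :
    bracket 𝓘(ℝ, E).tangent Pi (f ∘ φ) (g ∘ φ) v =
      wedgePair (tensorMap (mfderiv 𝓘(ℝ, E).tangent 𝓘(ℝ, E) φ v)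
        (mfderiv 𝓘(ℝ, E).tangent 𝓘(ℝ, E) φ v) (Pi v))
        (mvfderiv 𝓘(ℝ, E) f (φ v)) (mvfderiv 𝓘(ℝ, E) g (φ v)) := by
  have h {f : P → 𝕜} (hf : MDifferentiableAt 𝓘(ℝ, E) 𝓘(ℝ, 𝕜) f (φ v)) :
      mvfderiv 𝓘(ℝ, E).tangent (f ∘ φ) v =
        (mvfderiv 𝓘(ℝ, E) f (φ v)).comp (mfderiv 𝓘(ℝ, E).tangent 𝓘(ℝ, E) φ v) := by
    rw [mvfderiv, mfderiv_comp v hf hφ]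
    rfl
  rw [bracket, h hf, h hg, wedgePair_comp]

omit [CompleteSpace E] in
/-- Bivectors are determined by their values on the differentials of smooth functions. -/
lemma IsBivector.ext_mvfderiv [T2Space P] (𝕜 : Type*) [RCLike 𝕜] {y : P}
    {t t' : TangentSpace 𝓘(ℝ, E) y ⊗[ℝ] TangentSpace 𝓘(ℝ, E) y}
    (ht : IsBivector t) (ht' : IsBivector t')
    (h : ∀ f g : P → 𝕜, ContMDiff 𝓘(ℝ, E) 𝓘(ℝ, 𝕜) ∞ f → ContMDiff 𝓘(ℝ, E) 𝓘(ℝ, 𝕜) ∞ g →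
      wedgePair t (mvfderiv 𝓘(ℝ, E) f y) (mvfderiv 𝓘(ℝ, E) g y) =
        wedgePair t' (mvfderiv 𝓘(ℝ, E) f y) (mvfderiv 𝓘(ℝ, E) g y)) : t = t' := by
  choose f hf _ hdf using exists_coordinate_coframe (E := E) y
  -- Real coordinates viewed as `𝕜`-valued functions are enough to test on, so the criterion is the
  -- same over `ℝ` and `ℂ`.
  have hF (i) : ContMDiff 𝓘(ℝ, E) 𝓘(ℝ, 𝕜) ∞ ((RCLike.ofRealCLM : ℝ →L[ℝ] 𝕜) ∘ f i) :=
    (RCLike.ofRealCLM : ℝ →L[ℝ] 𝕜).contMDiff.comp (hf i)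
  have hdF (i) : mvfderiv 𝓘(ℝ, E) ((RCLike.ofRealCLM : ℝ →L[ℝ] 𝕜) ∘ f i) y =
      RCLike.ofRealCLM.comp (coframe y i y) := by
    rw [← (hdf i).self_of_nhds, mvfderiv, mfderiv_comp y
      (RCLike.ofRealCLM : ℝ →L[ℝ] 𝕜).mdifferentiableAt ((hf i y).mdifferentiableAt (by simp)),
      ContinuousLinearMap.mfderiv_eq]
    rfl
  refine ext_pair (fun i => coframe y i y) (fun u hu => ?_) fun i j => ?_
  · rw [← sum_coframe_smul_frame (mem_chart_source E y) u]
    simp [hu]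
  · have hij := h _ _ (hF i) (hF j)
    rw [hdF, hdF, ht.wedgePair_eq, ht'.wedgePair_eq, pair_ofReal, pair_ofReal] at hij
    exact_mod_cast hij

end Maps

end PoissonTangent

theorem mainTheorem5 {𝕜 : Type*} [RCLike 𝕜]
    {E : Type*} [NormedAddCommGroup E] [NormedSpace ℝ E] [FiniteDimensional ℝ E] [CompleteSpace E]
    {P : Type*} [TopologicalSpace P] [ChartedSpace E P] [IsManifold 𝓘(ℝ, E) ∞ P] [T2Space P]
    (η : ∀ x : P, TangentSpace 𝓘(ℝ, E) x ⊗[ℝ] TangentSpace 𝓘(ℝ, E) x)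
    (hη : IsPoisson 𝓘(ℝ, E) η)
    (cov : CovariantDerivative 𝓘(ℝ, E) E (TangentSpace 𝓘(ℝ, E) : P → Type _))
    [CovariantDerivative.ContMDiffCovariantDerivative cov ∞]
    (htors : cov.torsion = 0)
    (φ : TangentBundle 𝓘(ℝ, E) P → P)
    (hφ : ContMDiff 𝓘(ℝ, E).tangent 𝓘(ℝ, E) ∞ φ) :
    -- the bivector field `tangentPoisson η` is the one determined by the three defining equations
    (∀ Pi : (∀ v : TangentBundle 𝓘(ℝ, E) P,
        TangentSpace 𝓘(ℝ, E).tangent v ⊗[ℝ] TangentSpace 𝓘(ℝ, E).tangent v),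
      IsTangentPoisson η Pi ↔ Pi = tangentPoisson η) ∧
    -- the bracket of pull-backs
    (∀ f g : P → 𝕜, ContMDiff 𝓘(ℝ, E) 𝓘(ℝ, 𝕜) ∞ f → ContMDiff 𝓘(ℝ, E) 𝓘(ℝ, 𝕜) ∞ g →
      ∀ v : TangentBundle 𝓘(ℝ, E) P,
        bracket 𝓘(ℝ, E).tangent (tangentPoisson η) (f ∘ φ) (g ∘ φ) v =
          wedgePair
            (tensorMap (vertDeriv φ v) (vertDeriv φ v) (covDerivBivector cov η v)
              + (2 : ℝ) • tensorMap (vertDeriv φ v) (horDeriv cov φ v) (η v.proj))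
            (mvfderiv 𝓘(ℝ, E) f (φ v)) (mvfderiv 𝓘(ℝ, E) g (φ v))) ∧
    -- the characterization of Poisson maps
    (IsPoissonMap 𝓘(ℝ, E) 𝕜 𝓘(ℝ, E).tangent (tangentPoisson η) η φ ↔
      ∀ v : TangentBundle 𝓘(ℝ, E) P,
        (1 / 2 : ℝ) • symProd (vertDeriv φ v) (vertDeriv φ v) (covDerivBivector cov η v)
          + symProd (vertDeriv φ v) (horDeriv cov φ v) (η v.proj) = η (φ v)) := by
  have hbr {f g : P → 𝕜} (hf : ContMDiff 𝓘(ℝ, E) 𝓘(ℝ, 𝕜) ∞ f)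
      (hg : ContMDiff 𝓘(ℝ, E) 𝓘(ℝ, 𝕜) ∞ g) (v : TangentBundle 𝓘(ℝ, E) P) :=
    bracket_comp (tangentPoisson η) ((hφ v).mdifferentiableAt (by simp))
      ((hf (φ v)).mdifferentiableAt (by simp)) ((hg (φ v)).mdifferentiableAt (by simp))
  refine ⟨isTangentPoisson_iff hη, fun f g hf hg v => ?_, ?_⟩
  · rw [hbr hf hg, tensorMap_tangentPoisson htors,
      (hη.isBivector v.proj).wedgePair_add_tensorMap]
  -- As `A ⊙ A = 2 A ⊗ A`, the left side of the criterion is the push-forward of the bivector of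
  -- `TP`; it then remains to compare two bivectors at `φ v`.
  · have hsym (v : TangentBundle 𝓘(ℝ, E) P) :
        (1 / 2 : ℝ) • symProd (vertDeriv φ v) (vertDeriv φ v) (covDerivBivector cov η v)
          + symProd (vertDeriv φ v) (horDeriv cov φ v) (η v.proj) =
        tensorMap (mfderiv 𝓘(ℝ, E).tangent 𝓘(ℝ, E) φ v)
          (mfderiv 𝓘(ℝ, E).tangent 𝓘(ℝ, E) φ v) (tangentPoisson η v) := by
      rw [tensorMap_tangentPoisson htors, symProd, LinearMap.add_apply]
      module
    simp only [hsym]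
    refine ⟨fun h v => ?_, fun h f g hf hg v => ?_⟩
    · refine IsBivector.ext_mvfderiv 𝕜
        ((isBivector_tangentPoisson hη.isBivector v).tensorMap _) (hη.isBivector _)
        fun f g hf hg => ?_
      rw [← hbr hf hg]
      exact h f g hf hg v
    · rw [hbr hf hg, h v, bracket]
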